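/- Let $w=(w(n))_{n\ge 1}$ be a bounded sequence of strictly positive real numbers, and let $\ell_1(w)$ be the Banach space of all complex sequences $x=(x_n)_{n\ge1}$ with $\|x\|_{1,w}:=\sum_{n=1}^\infty w(n)|x_n|<\infty$. Suppose that the discrete Cesàro operator $$\mathsf{C}x:=\left(\frac{x_1+\dots+x_n}{n}\right)_{n\ge 1}$$ maps $\ell_1(w)$ continuously into itself, and that the resulting operator $\mathsf{C}^{(1,w)}\colon \ell_1(w)\to\ell_1(w)$ is compact. Then $$\mathcal{U}_w:=\sup_{m\ge 1}\frac{1}{m\,w(m+1)}\sum_{n=m+1}^\infty w(n)<\infty .$$ In particular, $\mathsf{C}^{(1,w)}$ is power bounded, i.e. $\sup_{n\ge1}\|(\mathsf{C}^{(1,w)})^n\|<\infty$, and uniformly mean ergodic, i.e. the averages $\frac1n\sum_{m=1}^n(\mathsf{C}^{(1,w)})^m$ converge in the operator norm, as $n\to\infty$, to a bounded linear operator on $\ell_1(w)$. -/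

import Mathlib

open Filter Topology
open scoped ENNReal

/-- A weight: a bounded, strictly positive sequence `(w(n))_{n ≥ 1}`.
Throughout, sequences are indexed by `ℕ` starting from `0`: the Lean index `n` stands for the
mathematical index `n + 1`, so that the term `w 0` is `w(1)`, the term `w 1` is `w(2)`, etc. -/
structure Weight where
  toFun : ℕ → ℝ
  pos : ∀ n, 0 < toFun n
  bounded : ∃ B : ℝ, ∀ n, toFun n ≤ B

instance : CoeFun Weight fun _ => ℕ → ℝ := ⟨Weight.toFun⟩

/-- The vector space of all complex sequences `x` with `∑ w(n) |x_n| < ∞`. -/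
def weightedL1Submodule (w : Weight) : Submodule ℂ (ℕ → ℂ) where
  carrier := {x | Summable fun n => w n * ‖x n‖}
  zero_mem' := by
    show Summable fun n => w n * ‖(0 : ℕ → ℂ) n‖
    simp
  add_mem' := by
    intro x y hx hy
    refine Summable.of_nonneg_of_le (fun n => mul_nonneg (w.pos n).le (norm_nonneg _))
      (fun n => ?_) (Summable.add hx hy)
    have h := mul_le_mul_of_nonneg_left (norm_add_le (x n) (y n)) (w.pos n).le
    simpa [mul_add] using h
  smul_mem' := by
    intro c x hx
    have h : Summable fun n => ‖c‖ * (w n * ‖x n‖) := Summable.mul_left ‖c‖ hx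
    refine h.congr fun n => ?_
    simp only [Pi.smul_apply, smul_eq_mul, norm_mul]
    ring

/-- The weighted space `ℓ₁(w)`. It is a separate type, so that it carries the topology of the
norm `‖x‖_{1,w}` below and not the topology of coordinatewise convergence. -/
def WeightedL1 (w : Weight) : Type := weightedL1Submodule w

namespace WeightedL1

variable {w : Weight}

instance : CoeFun (WeightedL1 w) fun _ => ℕ → ℂ := ⟨fun x => x.1⟩

instance : AddCommGroup (WeightedL1 w) := inferInstanceAs (AddCommGroup (weightedL1Submodule w))

instance : Module ℂ (WeightedL1 w) := inferInstanceAs (Module ℂ (weightedL1Submodule w))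

theorem summable (x : WeightedL1 w) : Summable fun n => w n * ‖x n‖ := x.2

theorem term_nonneg (x : WeightedL1 w) (n : ℕ) : 0 ≤ w n * ‖x n‖ :=
  mul_nonneg (w.pos n).le (norm_nonneg _)

theorem ext {x y : WeightedL1 w} (h : ∀ n, x n = y n) : x = y := Subtype.ext (funext h)

@[simp] theorem zero_apply (n : ℕ) : (0 : WeightedL1 w) n = 0 := rfl

@[simp] theorem add_apply (x y : WeightedL1 w) (n : ℕ) : (x + y) n = x n + y n := rfl

@[simp] theorem neg_apply (x : WeightedL1 w) (n : ℕ) : (-x) n = -x n := rfl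

@[simp] theorem smul_apply (c : ℂ) (x : WeightedL1 w) (n : ℕ) : (c • x) n = c * x n := rfl

/-- The norm `‖x‖_{1,w} = ∑ w(n) |x_n|`. -/
noncomputable def l1Norm (w : Weight) : AddGroupNorm (WeightedL1 w) where
  toFun x := ∑' n, w n * ‖x n‖
  map_zero' := by simp
  add_le' := by
    intro x y
    rw [← (summable x).tsum_add (summable y)]
    refine (summable (x + y)).tsum_le_tsum (fun n => ?_) ((summable x).add (summable y))
    have h := mul_le_mul_of_nonneg_left (norm_add_le (x n) (y n)) (w.pos n).le
    simpa [mul_add] using h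
  neg' := by intro x; simp
  eq_zero_of_map_eq_zero' := by
    intro x hx
    have h := ((summable x).hasSum_iff.2 hx)
    have h0 := (hasSum_zero_iff_of_nonneg (term_nonneg x)).1 h
    refine ext fun n => ?_
    have hn := congrFun h0 n
    simpa [(w.pos n).ne'] using hn

noncomputable instance : NormedAddCommGroup (WeightedL1 w) :=
  (l1Norm w).toNormedAddCommGroup

theorem norm_eq (x : WeightedL1 w) : ‖x‖ = ∑' n, w n * ‖x n‖ := rfl

noncomputable instance : NormedSpace ℂ (WeightedL1 w) where
  norm_smul_le c x := by
    rw [norm_eq, norm_eq, ← tsum_mul_left]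
    refine le_of_eq (tsum_congr fun n => ?_)
    rw [smul_apply, norm_mul]
    ring

end WeightedL1

/-- The discrete Cesàro operator on the space of all complex sequences,
`(C x)_n = (x_1 + ⋯ + x_n) / n` (with Lean index `n` standing for `n + 1`). -/
noncomputable def cesaro (x : ℕ → ℂ) (n : ℕ) : ℂ :=
  (∑ k ∈ Finset.range (n + 1), x k) / ((n : ℂ) + 1)

/-- `T` is the operator `C^{(1,w)}`: the continuous linear operator on `ℓ₁(w)` given by the
Cesàro operator. Such a `T` exists exactly when the Cesàro operator maps `ℓ₁(w)` continuously
into itself, and it is then unique. -/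
def IsCesaroOperator (w : Weight) (T : WeightedL1 w →L[ℂ] WeightedL1 w) : Prop :=
  ∀ (x : WeightedL1 w) (n : ℕ), T x n = cesaro x n

/-- `U_w = sup_{m ≥ 1} (1 / (m w(m+1))) ∑_{n ≥ m+1} w(n)`, a value in `[0, ∞]`.
The Lean index `m` stands for `m + 1`. -/
noncomputable def Uw (w : Weight) : ℝ≥0∞ :=
  ⨆ m : ℕ, (∑' n : ℕ, ENNReal.ofReal (w (m + 1 + n))) /
    ENNReal.ofReal (((m : ℝ) + 1) * w (m + 1))

section Operators

variable {E : Type*} [NormedAddCommGroup E] [NormedSpace ℂ E]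

/-- Power boundedness: `sup_{n ≥ 1} ‖T ^ n‖ < ∞`. -/
def PowerBounded (T : E →L[ℂ] E) : Prop :=
  ∃ M : ℝ, ∀ n : ℕ, 1 ≤ n → ‖T ^ n‖ ≤ M

/-- The averages `T_[n] = (1 / n) ∑_{m=1}^n T ^ m`. -/
noncomputable def cesaroAverage (T : E →L[ℂ] E) (n : ℕ) : E →L[ℂ] E :=
  (n : ℂ)⁻¹ • ∑ m ∈ Finset.Icc 1 n, T ^ m

/-- Uniform mean ergodicity: the averages `T_[n]` converge in the operator norm. -/
def UniformlyMeanErgodic (T : E →L[ℂ] E) : Prop :=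
  ∃ P : E →L[ℂ] E, Tendsto (cesaroAverage T) atTop (𝓝 P)

end Operators

/-! In Lean indices `‖T e_m‖ = ∑_{n ≥ m} w n / (n + 1)`, and compactness forces `‖T e_m‖ / w m → 0`,
so this ratio is at most `1/2` from some `N` on. Summation by parts turns that into `∑_{n ≥ m} w n ≤
m * w m`, which bounds all but finitely many terms of `Uw` by `1` and makes `w` summable
(`sum_weight_le`, `Uw_lt_top`). Since the operator is lower triangular, it also contracts the
vectors vanishing before `N`. The missing coordinates `m ≥ 1` are restored one at a time: each has
diagonal entry `1 / (m + 1) ≤ 1/2`, so decay like `(3/4)^n` survives (`exists_norm_pow_le`). What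
remains is the constant vector, which is fixed and lies in the space because `w` is summable. Hence
`T ^ n` converges in norm, which gives both ergodic statements. -/

namespace WeightedL1

variable {w : Weight}

theorem sub_apply (x y : WeightedL1 w) (n : ℕ) : (x - y) n = x n - y n := by
  rw [sub_eq_add_neg, add_apply, neg_apply, sub_eq_add_neg]

theorem sum_apply {ι : Type*} (s : Finset ι) (f : ι → WeightedL1 w) (n : ℕ) :
    (∑ i ∈ s, f i) n = ∑ i ∈ s, f i n := by
  classical
  induction s using Finset.induction_on with
  | empty => rfl
  | insert a s ha ih => rw [Finset.sum_insert ha, Finset.sum_insert ha, add_apply, ih]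

/-- The canonical unit vector `e_m`. -/
def unitVec (w : Weight) (m : ℕ) : WeightedL1 w :=
  ⟨Pi.single m 1, summable_of_ne_finset_zero (s := {m}) fun n hn => by
    simp only [Finset.mem_singleton] at hn
    simp [Pi.single_eq_of_ne hn]⟩

theorem unitVec_apply (m n : ℕ) : unitVec w m n = if n = m then 1 else 0 :=
  Pi.single_apply m (1 : ℂ) n

theorem norm_unitVec (m : ℕ) : ‖unitVec w m‖ = w m := by
  rw [norm_eq, tsum_eq_single m]
  · simp [unitVec_apply]
  · intro n hn
    simp [unitVec_apply, hn]

theorem le_norm (x : WeightedL1 w) (n : ℕ) : w n * ‖x n‖ ≤ ‖x‖ :=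
  (summable x).le_tsum n fun k _ => term_nonneg x k

/-- The coordinate functional `x ↦ x_n`. -/
noncomputable def coord (w : Weight) (n : ℕ) : WeightedL1 w →L[ℂ] ℂ :=
  LinearMap.mkContinuous
    { toFun := fun x => x n
      map_add' := fun _ _ => rfl
      map_smul' := fun _ _ => rfl } (w n)⁻¹ fun x => by
    rw [inv_mul_eq_div, le_div_iff₀' (w.pos n)]
    exact le_norm x n

@[simp] theorem coord_apply (n : ℕ) (x : WeightedL1 w) : coord w n x = x n := rfl

theorem hasSum_unitVec (x : WeightedL1 w) : HasSum (fun m => x m • unitVec w m) x := by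
  rw [HasSum, SummationFilter.unconditional_filter, tendsto_iff_norm_sub_tendsto_zero]
  refine (tendsto_tsum_compl_atTop_zero fun n => w n * ‖x n‖).congr fun s => ?_
  refine (tsum_subtype {a | a ∉ s} fun n => w n * ‖x n‖).trans ?_
  rw [norm_eq]
  refine tsum_congr fun n => ?_
  rw [WeightedL1.sub_apply, sum_apply]
  by_cases hn : n ∈ s <;> simp [unitVec_apply, hn]

/-- A bound for an operator on the vectors with vanishing first `N` coordinates follows from the
same bound on the unit vectors. -/
theorem norm_map_le_of_unitVec (T : WeightedL1 w →L[ℂ] WeightedL1 w) {N : ℕ} {c : ℝ}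
    (hc : ∀ m, N ≤ m → ‖T (unitVec w m)‖ ≤ c * w m) (x : WeightedL1 w)
    (hx : ∀ k < N, x k = 0) : ‖T x‖ ≤ c * ‖x‖ := by
  have h1 : HasSum (fun m => x m • T (unitVec w m)) (T x) := by
    simpa using (hasSum_unitVec x).mapL T
  have h2 : HasSum (fun m => c * (w m * ‖x m‖)) (c * ‖x‖) :=
    (summable x).hasSum.mul_left c
  refine h1.norm_le_of_bounded h2 fun m => ?_
  rw [norm_smul]
  rcases lt_or_ge m N with h | h
  · simp [hx m h]
  · calc ‖x m‖ * ‖T (unitVec w m)‖ ≤ ‖x m‖ * (c * w m) := by gcongr; exact hc m h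
      _ = c * (w m * ‖x m‖) := by ring

end WeightedL1

open WeightedL1

/-! ### Compactness and the tails of the weight. -/

namespace IsCesaroOperator

variable {w : Weight} {T : WeightedL1 w →L[ℂ] WeightedL1 w}

theorem apply_unitVec (hT : IsCesaroOperator w T) (m n : ℕ) :
    T (unitVec w m) n = if m ≤ n then 1 / ((n : ℂ) + 1) else 0 := by
  rw [hT, cesaro]
  simp [unitVec_apply, ite_div]

/-- The images of consecutive unit vectors differ only in coordinate `m`. This recursion drives the
summation by parts. -/
theorem norm_apply_unitVec (hT : IsCesaroOperator w T) (m : ℕ) :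
    ‖T (unitVec w m)‖ = w m / (m + 1) + ‖T (unitVec w (m + 1))‖ := by
  have h0 : w m / (m + 1) = ‖((m : ℂ) + 1)⁻¹ • unitVec w m‖ := by
    have h : ‖(m : ℂ) + 1‖ = m + 1 := by exact_mod_cast Complex.norm_natCast (m + 1)
    rw [norm_smul, norm_unitVec, norm_inv, h, inv_mul_eq_div]
  rw [h0, norm_eq, norm_eq, norm_eq, ← (summable _).tsum_add (summable _)]
  refine tsum_congr fun n => ?_
  rw [WeightedL1.smul_apply, hT.apply_unitVec, hT.apply_unitVec, unitVec_apply]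
  rcases lt_trichotomy n m with h | h | h
  · simp [h.ne, h.not_ge, (h.trans (Nat.lt_succ_self m)).not_ge]
  · subst h
    simp
  · simp [h.ne', h.le, Nat.succ_le_of_lt h]

theorem apply_eq_zero (hT : IsCesaroOperator w T) {N : ℕ} {x : WeightedL1 w}
    (hx : ∀ k < N, x k = 0) : ∀ k < N, T x k = 0 := by
  intro k hk
  rw [hT, cesaro, Finset.sum_eq_zero, zero_div]
  intro i hi
  exact hx i (by simp at hi; omega)

/-- Compactness forces `‖C e_m‖ / ‖e_m‖ → 0`. -/
theorem tendsto_norm_unitVec (hT : IsCesaroOperator w T) (hcompact : IsCompactOperator T) :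
    Tendsto (fun m => ‖T (unitVec w m)‖ / w m) atTop (𝓝 0) := by
  obtain ⟨K, hK, hsub⟩ := hcompact.image_closedBall_subset_compact (𝕜₁ := ℂ) (f := T.toLinearMap) 1
  have hmem : ∀ m, T (((w m : ℂ))⁻¹ • unitVec w m) ∈ K := fun m => by
    refine hsub ⟨_, ?_, rfl⟩
    rw [mem_closedBall_zero_iff, norm_smul, norm_unitVec, norm_inv, Complex.norm_real,
      Real.norm_of_nonneg (w.pos m).le, inv_mul_cancel₀ (w.pos m).ne']
  have hlim : Tendsto (fun m => T (((w m : ℂ))⁻¹ • unitVec w m)) atTop (𝓝 0) := by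
    -- In a compact set it suffices that `0` is the only cluster point; each coordinate of the
    -- sequence is eventually zero.
    refine hK.tendsto_nhds_of_unique_mapClusterPt (Eventually.of_forall hmem) fun y _ hy => ?_
    refine WeightedL1.ext fun n => ?_
    have h1 := hy.continuousAt_comp (coord w n).continuous.continuousAt
    have h2 : Tendsto (coord w n ∘ fun m => T (((w m : ℂ))⁻¹ • unitVec w m)) atTop (𝓝 0) := by
      refine tendsto_const_nhds.congr' ?_
      filter_upwards [eventually_gt_atTop n] with m hm
      simp [hT.apply_unitVec, hm.not_ge]
    have : (𝓝 (y n) ⊓ 𝓝 (0 : ℂ)).NeBot := ClusterPt.mono h1 h2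
    exact eq_of_nhds_neBot this
  refine (tendsto_zero_iff_norm_tendsto_zero.1 hlim).congr fun m => ?_
  rw [map_smul, norm_smul, norm_inv, Complex.norm_real, Real.norm_of_nonneg (w.pos m).le,
    inv_mul_eq_div]

/-- The value `1/2` makes the tail bound exactly `m * w m` and stays below the decay rate `3/4`. -/
theorem exists_norm_unitVec_le (hT : IsCesaroOperator w T) (hcompact : IsCompactOperator T) :
    ∃ N, ∀ m, N ≤ m → ‖T (unitVec w m)‖ ≤ 1 / 2 * w m := by
  have h := (hT.tendsto_norm_unitVec hcompact).eventually_le_const (by norm_num : (0 : ℝ) < 1 / 2)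
  obtain ⟨N, hN⟩ := eventually_atTop.1 h
  exact ⟨N, fun m hm => (div_le_iff₀ (w.pos m)).1 (hN m hm)⟩

/-- Summation by parts for the tails `∑_{n ≥ m} w(n) / n`. -/
theorem sum_weight_le (hT : IsCesaroOperator w T) {m : ℕ}
    (hm : ∀ j, m ≤ j → ‖T (unitVec w j)‖ ≤ 1 / 2 * w j) (k : ℕ) :
    ∑ n ∈ Finset.range k, w (m + n) ≤ m * w m := by
  -- With `r j = ‖T e_j‖`, the recursion gives `(j + 1) * r (j + 1) - j * r j = r j - w j ≤ -w j /
  -- 2`, which telescopes.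
  have key : ∀ k : ℕ, (∑ n ∈ Finset.range k, w (m + n)) / 2 +
      ((m + k : ℕ) : ℝ) * ‖T (unitVec w (m + k))‖ ≤ m * ‖T (unitVec w m)‖ := by
    intro k
    induction k with
    | zero => simp
    | succ k ih =>
      rw [Finset.sum_range_succ]
      have h1 := hT.norm_apply_unitVec (m + k)
      have h2 := hm (m + k) (by omega)
      have h3 : ((m + (k + 1) : ℕ) : ℝ) * ‖T (unitVec w (m + k + 1))‖ =
          (((m + k : ℕ) : ℝ) + 1) * ‖T (unitVec w (m + k))‖ - w (m + k) := by
        rw [h1]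
        push_cast
        field_simp
        ring
      rw [← add_assoc] at h3 ⊢
      linarith
  have h1 := key k
  have h2 : 0 ≤ ((m + k : ℕ) : ℝ) * ‖T (unitVec w (m + k))‖ := by positivity
  have h3 := mul_le_mul_of_nonneg_left (hm m le_rfl) (Nat.cast_nonneg (α := ℝ) m)
  linarith

theorem summable_weight (hT : IsCesaroOperator w T) (hcompact : IsCompactOperator T) :
    Summable fun n => w n := by
  obtain ⟨N, hN⟩ := hT.exists_norm_unitVec_le hcompact
  rw [← summable_nat_add_iff N]
  simp_rw [add_comm _ N]
  exact summable_of_sum_range_le (fun n => (w.pos _).le) (hT.sum_weight_le hN)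

theorem Uw_lt_top (hT : IsCesaroOperator w T) (hcompact : IsCompactOperator T) : Uw w < ∞ := by
  obtain ⟨N, hN⟩ := hT.exists_norm_unitVec_le hcompact
  have hsum := hT.summable_weight hcompact
  have hpos : ∀ m : ℕ, 0 < ((m : ℝ) + 1) * w (m + 1) := fun m =>
    mul_pos (by positivity) (w.pos _)
  have hbdd : BddAbove (Set.range fun m : ℕ =>
      (∑' n : ℕ, w (m + 1 + n)) / (((m : ℝ) + 1) * w (m + 1))) := by
    -- An eventual bound suffices: the finitely many other terms are real numbers.
    refine IsBoundedUnder.bddAbove_range ⟨1, eventually_map.2 ?_⟩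
    filter_upwards [eventually_ge_atTop N] with m hm
    rw [div_le_one (hpos m)]
    have := Real.tsum_le_of_sum_range_le (fun n => (w.pos _).le)
      (hT.sum_weight_le (m := m + 1) fun j hj => hN j (by omega))
    simpa using this
  obtain ⟨c, hc⟩ := hbdd
  refine lt_of_le_of_lt (iSup_le fun m => ?_) (ENNReal.ofReal_lt_top (r := c))
  have hs : Summable fun n => w (m + 1 + n) := by
    simpa only [add_comm] using (summable_nat_add_iff (m + 1)).2 hsum
  rw [← ENNReal.ofReal_tsum_of_nonneg (fun n => (w.pos _).le) hs,
    ← ENNReal.ofReal_div_of_pos (hpos m)]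
  exact ENNReal.ofReal_le_ofReal (hc ⟨m, rfl⟩)

/-! ### Decay and convergence of the powers. -/

/-- If the powers of `C` decay exponentially on the vectors with vanishing first `m + 1`
coordinates, where `m ≥ 1`, they do so on the vectors with vanishing first `m` coordinates. -/
theorem exists_norm_pow_le_of_succ (hT : IsCesaroOperator w T) {m : ℕ} (hm : 1 ≤ m)
    (h : ∃ K : ℝ, ∀ x : WeightedL1 w, (∀ k < m + 1, x k = 0) →
      ∀ n, ‖(T ^ n) x‖ ≤ K * (3 / 4) ^ n * ‖x‖) :
    ∃ K : ℝ, ∀ x : WeightedL1 w, (∀ k < m, x k = 0) →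
      ∀ n, ‖(T ^ n) x‖ ≤ K * (3 / 4) ^ n * ‖x‖ := by
  obtain ⟨K, hK⟩ := h
  set e := unitVec w m with he
  set c : ℂ := ((m : ℂ) + 1)⁻¹ with hc
  -- Here `1 ≤ m` matters: for `m = 0` the diagonal entry is `1`.
  have hcn : ‖c‖ ≤ 1 / 2 := by
    rw [hc, norm_inv, ← Nat.cast_succ, Complex.norm_natCast, one_div]
    refine inv_anti₀ two_pos ?_
    exact_mod_cast Nat.succ_le_succ hm
  set u := T e - c • e with hu
  have hu0 : ∀ k < m + 1, u k = 0 := by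
    intro k hk
    rw [hu, WeightedL1.sub_apply, WeightedL1.smul_apply, he, hT.apply_unitVec, unitVec_apply]
    rcases (Nat.lt_succ_iff.1 hk).lt_or_eq with h | h
    · simp [h.ne, h.not_ge]
    · simp [h, hc]
  -- `‖e‖` covers `n = 0`; the factor `4` closes the induction through `1/2 + 1/4 = 3/4`.
  set L : ℝ := max ‖e‖ (4 * (K * ‖u‖)) with hL
  have hLn : ∀ n, ‖(T ^ n) e‖ ≤ L * (3 / 4) ^ n := by
    intro n
    induction n with
    | zero => simp [hL]
    | succ n ih =>
      have h1 : (T ^ (n + 1)) e = c • (T ^ n) e + (T ^ n) u := by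
        rw [← map_smul, ← map_add, hu, add_sub_cancel, pow_succ]
        rfl
      have h2 := hK u hu0 n
      have h3 : ‖c‖ * ‖(T ^ n) e‖ ≤ 1 / 2 * (L * (3 / 4) ^ n) := by gcongr
      have h4 : 4 * (K * ‖u‖) * (3 / 4) ^ n ≤ L * (3 / 4) ^ n := by
        gcongr
        exact le_max_right _ _
      have h5 := norm_add_le (c • (T ^ n) e) ((T ^ n) u)
      rw [norm_smul] at h5
      rw [h1, pow_succ]
      linarith
  have hL0 : 0 ≤ L := (norm_nonneg e).trans (le_max_left _ _)
  refine ⟨L / w m + |K| * 2, fun x hx n => ?_⟩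
  have hxm : ‖x m‖ ≤ ‖x‖ / w m := (le_div_iff₀' (w.pos m)).2 (le_norm x m)
  have hrest : ‖x - x m • e‖ ≤ 2 * ‖x‖ := by
    refine (norm_sub_le _ _).trans ?_
    rw [norm_smul, he, norm_unitVec, mul_comm]
    linarith [le_norm x m]
  have h1 : ‖(T ^ n) (x - x m • e)‖ ≤ |K| * (3 / 4) ^ n * (2 * ‖x‖) := by
    refine (hK _ (fun k hk => ?_) n).trans ?_
    · rw [WeightedL1.sub_apply, WeightedL1.smul_apply, he, unitVec_apply]
      rcases (Nat.lt_succ_iff.1 hk).lt_or_eq with h | h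
      · simp [h.ne, hx k h]
      · simp [h]
    · gcongr
      exact le_abs_self K
  have h2 : ‖x m • (T ^ n) e‖ ≤ ‖x‖ / w m * (L * (3 / 4) ^ n) := by
    rw [norm_smul]
    exact mul_le_mul hxm (hLn n) (norm_nonneg _) (by have := (w.pos m).le; positivity)
  have h3 : (T ^ n) x = (T ^ n) (x - x m • e) + x m • (T ^ n) e := by
    rw [map_sub, map_smul, sub_add_cancel]
  rw [h3]
  refine (norm_add_le _ _).trans ((add_le_add h1 h2).trans (le_of_eq ?_))
  ring

/-- The powers of `C` decay exponentially on the vectors with vanishing first coordinate. -/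
theorem exists_norm_pow_le (hT : IsCesaroOperator w T) (hcompact : IsCompactOperator T) :
    ∃ K : ℝ, ∀ x : WeightedL1 w, x 0 = 0 → ∀ n, ‖(T ^ n) x‖ ≤ K * (3 / 4) ^ n * ‖x‖ := by
  obtain ⟨N, hN⟩ := hT.exists_norm_unitVec_le hcompact
  -- Starting from `N + 1` lets the descent end at `1` even if `N = 0`.
  have hbase : ∃ K : ℝ, ∀ x : WeightedL1 w, (∀ k < N + 1, x k = 0) →
      ∀ n, ‖(T ^ n) x‖ ≤ K * (3 / 4) ^ n * ‖x‖ := by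
    refine ⟨1, fun x hx n => ?_⟩
    induction n generalizing x with
    | zero => simp
    | succ n ih =>
      have h1 := ih (T x) (hT.apply_eq_zero hx)
      have h2 := norm_map_le_of_unitVec T hN x fun k hk => hx k (by omega)
      have h3 : (T ^ (n + 1)) x = (T ^ n) (T x) := by rw [pow_succ]; rfl
      rw [h3]
      calc ‖(T ^ n) (T x)‖ ≤ 1 * (3 / 4) ^ n * ‖T x‖ := h1
        _ ≤ 1 * (3 / 4) ^ n * (3 / 4 * ‖x‖) := by
          gcongr
          linarith [norm_nonneg x]
        _ = 1 * (3 / 4) ^ (n + 1) * ‖x‖ := by ring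
  have hone := Nat.decreasingInduction (n := N + 1)
    (motive := fun m _ => 1 ≤ m → ∃ K : ℝ, ∀ x : WeightedL1 w, (∀ k < m, x k = 0) →
      ∀ n, ‖(T ^ n) x‖ ≤ K * (3 / 4) ^ n * ‖x‖)
    (fun m _ ih hm => hT.exists_norm_pow_le_of_succ hm (ih (by omega)))
    (fun _ => hbase) (Nat.le_add_left 1 N) le_rfl
  obtain ⟨K, hK⟩ := hone
  exact ⟨K, fun x hx => hK x fun k hk => by rwa [Nat.lt_one_iff.1 hk]⟩

/-- The powers of a compact Cesàro operator converge in norm, to the projection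
`x ↦ (x_1, x_1, …)`. -/
theorem exists_tendsto_pow (hT : IsCesaroOperator w T) (hcompact : IsCompactOperator T) :
    ∃ P : WeightedL1 w →L[ℂ] WeightedL1 w, Tendsto (fun n => T ^ n) atTop (𝓝 P) := by
  obtain ⟨K, hK⟩ := hT.exists_norm_pow_le hcompact
  let one : WeightedL1 w := ⟨fun _ => 1, by
    show Summable fun n => w n * ‖(1 : ℂ)‖
    simpa using hT.summable_weight hcompact⟩
  have hone_apply : ∀ n, one n = 1 := fun _ => rfl
  have hfix : T one = one := WeightedL1.ext fun n => by
    rw [hT, cesaro]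
    simp only [hone_apply, Finset.sum_const, Finset.card_range, nsmul_eq_mul, mul_one]
    push_cast
    exact div_self (Nat.cast_add_one_ne_zero n)
  have hfixn : ∀ n, (T ^ n) one = one := by
    intro n
    induction n with
    | zero => rfl
    | succ n ih =>
      rw [pow_succ]
      exact (congrArg (T ^ n) hfix).trans ih
  let P : WeightedL1 w →L[ℂ] WeightedL1 w := (coord w 0).smulRight one
  have hP : ∀ x, P x = x 0 • one := fun _ => rfl
  refine ⟨P, ?_⟩
  have hbound : ∀ n, ‖T ^ n - P‖ ≤ |K| * (1 + ‖P‖) * (3 / 4) ^ n := by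
    intro n
    refine ContinuousLinearMap.opNorm_le_bound _ (by positivity) fun x => ?_
    -- The range of `P` is fixed by `T`, and `x - P x` vanishes at coordinate `0`, where the decay
    -- applies.
    have h1 : (T ^ n - P) x = (T ^ n) (x - P x) := by
      rw [_root_.sub_apply, map_sub, hP, map_smul, hfixn]
    have h2 : (x - P x) 0 = 0 := by
      rw [WeightedL1.sub_apply, hP, WeightedL1.smul_apply, hone_apply, mul_one, sub_self]
    have h3 : ‖x - P x‖ ≤ (1 + ‖P‖) * ‖x‖ := by
      have := norm_sub_le x (P x)
      have := P.le_opNorm x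
      linarith
    rw [h1]
    calc ‖(T ^ n) (x - P x)‖ ≤ K * (3 / 4) ^ n * ‖x - P x‖ := hK _ h2 n
      _ ≤ |K| * (3 / 4) ^ n * ((1 + ‖P‖) * ‖x‖) := by
        gcongr
        exact le_abs_self K
      _ = |K| * (1 + ‖P‖) * (3 / 4) ^ n * ‖x‖ := by ring
  rw [tendsto_iff_norm_sub_tendsto_zero]
  refine squeeze_zero (fun _ => norm_nonneg _) hbound ?_
  simpa using (tendsto_pow_atTop_nhds_zero_of_lt_one (by norm_num : (0 : ℝ) ≤ 3 / 4)
    (by norm_num)).const_mul (|K| * (1 + ‖P‖))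

end IsCesaroOperator

section Operators

variable {E : Type*} [NormedAddCommGroup E] [NormedSpace ℂ E] {T P : E →L[ℂ] E}

theorem PowerBounded.of_tendsto_pow (h : Tendsto (fun n => T ^ n) atTop (𝓝 P)) :
    PowerBounded T := by
  obtain ⟨M, hM⟩ := h.norm.bddAbove_range
  exact ⟨M, fun n _ => hM ⟨n, rfl⟩⟩

theorem UniformlyMeanErgodic.of_tendsto_pow (h : Tendsto (fun n => T ^ n) atTop (𝓝 P)) :
    UniformlyMeanErgodic T := by
  -- Averages inherit the limit of the powers; the shift is needed because they start at `T ^ 1`.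
  refine ⟨P, (((tendsto_add_atTop_iff_nat 1).2 h).cesaro_smul).congr fun n => ?_⟩
  have h1 : ∑ m ∈ Finset.Icc 1 n, T ^ m = ∑ i ∈ Finset.range n, T ^ (i + 1) := by
    rw [Finset.range_eq_Ico, Finset.sum_Ico_add' (fun m => T ^ m) 0 n 1]
    rfl
  rw [cesaroAverage, h1, ← Complex.coe_smul]
  push_cast
  rfl

end Operators

theorem proposition4p12 (w : Weight) (T : WeightedL1 w →L[ℂ] WeightedL1 w)
    (hT : IsCesaroOperator w T) (hcompact : IsCompactOperator T) :
    Uw w < ∞ ∧ PowerBounded T ∧ UniformlyMeanErgodic T := by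
  obtain ⟨P, hP⟩ := hT.exists_tendsto_pow hcompact
  exact ⟨hT.Uw_lt_top hcompact, .of_tendsto_pow hP, .of_tendsto_pow hP⟩
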